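/- **Theorem (Semicircle law for HDQI).** A *commuting Pauli Hamiltonian* with $m$ terms on $n$ qubits is $H=\sum_{i=1}^m v_iP_i$ with signs $v_i\in\{\pm1\}$ and pairwise commuting Pauli operators $P_i\in\{I,X,Y,Z\}^{\otimes n}$. Let $\mathrm{symp}(P)\in\mathbb F_2^{2n}$ record the $X$-components and the $Z$-components of $P$ (for each qubit: $I\mapsto(0,0)$, $X\mapsto(1,0)$, $Z\mapsto(0,1)$, $Y\mapsto(1,1)$), let $B^{\mathsf T}\in\mathbb F_2^{2n\times m}$ be the matrix with columns $\mathrm{symp}(P_1),\dots,\mathrm{symp}(P_m)$, let $\mathrm{Symp}(H)=\{y\in\mathbb F_2^m: B^{\mathsf T}y=0\}$, and let $d^\perp(H)$ be the minimum Hamming weight of a nonzero element of $\mathrm{Symp}(H)$ ($d^\perp(H)=\infty$ if $\mathrm{Symp}(H)=\{0\}$). For a real polynomial $\mathcal P$ with $\mathcal P(H)\neq0$ put $\rho_{\mathcal P}(H)=\mathcal P(H)^2/\mathrm{Tr}[\mathcal P(H)^2]$. Let $\langle E\rangle$ be the expected energy obtained upon measuring $\rho_{\mathcal P}(H)$ in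 an eigenbasis of $H$, and let $\langle s\rangle=\sum_{i=1}^m \mathrm{Tr}\big[\rho_{\mathcal P}(H)\,\tfrac{1+v_iP_i}{2}\big]$ be the expected number of satisfied terms (a term is satisfied if measuring $v_iP_i$ gives $+1$); thus $\langle s\rangle=(m+\langle E\rangle)/2$. Call $\mathcal P$ *optimal* for $(H,\ell)$ if it maximizes $\langle E\rangle$ among all real polynomials of degree at most $\ell$ with $\mathcal P(H)\ne0$. Let $H_1,H_2,\dots$ be commuting Pauli Hamiltonians, $H_j$ having $m_j$ terms on $n_j$ qubits, and let $\ell_j\ge0$ be integers with $2\ell_j+1<d^\perp(H_j)$ for all $j$, $m_j\to\infty$, and $\ell_j/m_j\to\mu$ (for instance $\ell_j/m_j=\mu$ fixed). Then an optimal polynomial for $(H_j,\ell_j)$ exists for every $j$, and for every choice of optimal polynomials $\mathcal P_j$ the corresponding expectations $\langle s\rangle_j$, $\langle E\rangle_j$ satisfy $$\frac{\langle s\rangle_j}{m_j}\longrightarrow \sigma(\mu),\qquad \frac{\langle E\rangle_j}{m_j}\longrightarrow 2\,\sigma(\mu)-1,\qquad\text{where}\quad \sigma(\mu)=\begin{cases}\Big(\sqrt{\tfrac{\mu}{2}}+\sqrt{\tfrac12-\tfrac{\mu}{2}}\Big)^2,&\mu\le\tfrac12,\\[2pt]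 1,&\text{otherwise.}\end{cases}$$ -/

import Mathlib

noncomputable section

namespace HDQI

open Polynomial

/-- The labels of the four single-qubit Pauli operators. -/
inductive Pauli where
  | I
  | X
  | Y
  | Z

/-- The 2 × 2 matrix of a single-qubit Pauli operator. -/
def Pauli.toMatrix : Pauli → Matrix (Fin 2) (Fin 2) ℂ
  | Pauli.I => !![1, 0; 0, 1]
  | Pauli.X => !![0, 1; 1, 0]
  | Pauli.Y => !![0, -Complex.I; Complex.I, 0]
  | Pauli.Z => !![1, 0; 0, -1]

/-- The `X`-component of a single-qubit Pauli operator: `1` for `X` and `Y`. -/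
def Pauli.xBit : Pauli → ZMod 2
  | Pauli.I => 0
  | Pauli.X => 1
  | Pauli.Y => 1
  | Pauli.Z => 0

/-- The `Z`-component of a single-qubit Pauli operator: `1` for `Z` and `Y`. -/
def Pauli.zBit : Pauli → ZMod 2
  | Pauli.I => 0
  | Pauli.X => 0
  | Pauli.Y => 1
  | Pauli.Z => 1

/-- `n`-qubit Pauli operators, the elements of `{I, X, Y, Z}^{⊗ n}`. -/
abbrev PauliString (n : ℕ) := Fin n → Pauli

/-- Operators on the space of `n` qubits, in the computational basis
indexed by bitstrings of length `n`. -/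
abbrev Operator (n : ℕ) := Matrix (Fin n → Fin 2) (Fin n → Fin 2) ℂ

/-- The matrix of an `n`-qubit Pauli operator: the entries of a tensor product
of matrices are the products of the entries of the factors. -/
def PauliString.toMatrix {n : ℕ} (P : PauliString n) : Operator n :=
  fun x y => ∏ q, (P q).toMatrix (x q) (y q)

/-- The symplectic representation of an `n`-qubit Pauli operator, a vector in `𝔽₂^{2n}`:
the coordinates `Sum.inl q` hold the `X`-components, the coordinates `Sum.inr q` the
`Z`-components. -/
def PauliString.symp {n : ℕ} (P : PauliString n) : Fin n ⊕ Fin n → ZMod 2 :=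
  Sum.elim (fun q => (P q).xBit) (fun q => (P q).zBit)

/-- The data of a signed Pauli Hamiltonian `∑ᵢ vᵢ Pᵢ` with `m` terms on `n` qubits. -/
structure PauliHamiltonian (n m : ℕ) where
  /-- the signs `vᵢ ∈ {1, -1}` -/
  sign : Fin m → ℤˣ
  /-- the Pauli operators `Pᵢ` -/
  pauli : Fin m → PauliString n

namespace PauliHamiltonian

variable {n m : ℕ} (H : PauliHamiltonian n m)

/-- The signed term `vᵢ Pᵢ`. -/
def term (i : Fin m) : Operator n :=
  ((H.sign i : ℤ) : ℂ) • (H.pauli i).toMatrix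

/-- The Hamiltonian `H = ∑ᵢ vᵢ Pᵢ` as an operator. -/
def toMatrix : Operator n :=
  ∑ i, H.term i

/-- All the Pauli operators of `H` commute pairwise. -/
def IsCommuting : Prop :=
  ∀ i j, Commute (H.pauli i).toMatrix (H.pauli j).toMatrix

/-- The parity check matrix `Bᵀ ∈ 𝔽₂^{2n × m}`, whose `i`-th column is `symp(Pᵢ)`. -/
def parityCheck : Matrix (Fin n ⊕ Fin n) (Fin m) (ZMod 2) :=
  Matrix.of fun a i => (H.pauli i).symp a

/-- The symplectic code `Symp(H) ⊆ 𝔽₂^m`, the kernel of the parity check matrix. -/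
def sympCode : Submodule (ZMod 2) (Fin m → ZMod 2) :=
  LinearMap.ker H.parityCheck.mulVecLin

/-- The minimum distance of the symplectic code: the least Hamming weight of a nonzero
codeword, and `∞` if there is no nonzero codeword. -/
def sympDist : ℕ∞ :=
  ⨅ y ∈ {y : Fin m → ZMod 2 | y ∈ H.sympCode ∧ y ≠ 0}, (hammingNorm y : ℕ∞)

/-- The polynomial Hamiltonian state `ρ_𝒫(H) = 𝒫(H)² / Tr[𝒫(H)²]`
(a density matrix whenever `𝒫(H) ≠ 0`). -/
def polyState (P : ℝ[X]) : Operator n :=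
  (Matrix.trace ((aeval H.toMatrix P) ^ 2))⁻¹ • (aeval H.toMatrix P) ^ 2

end PauliHamiltonian

theorem Pauli.toMatrix_isHermitian (p : Pauli) : p.toMatrix.IsHermitian := by
  cases p <;> ext i j <;> fin_cases i <;> fin_cases j <;>
    simp [Pauli.toMatrix]

theorem PauliString.toMatrix_isHermitian {n : ℕ} (P : PauliString n) :
    P.toMatrix.IsHermitian := by
  ext x y
  simp only [Matrix.conjTranspose_apply, PauliString.toMatrix, star_prod]
  exact Finset.prod_congr rfl fun q _ => (P q).toMatrix_isHermitian.apply (x q) (y q)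

theorem PauliHamiltonian.toMatrix_isHermitian {n m : ℕ} (H : PauliHamiltonian n m) :
    H.toMatrix.IsHermitian := by
  unfold PauliHamiltonian.toMatrix PauliHamiltonian.term Matrix.IsHermitian
  rw [Matrix.conjTranspose_sum]
  refine Finset.sum_congr rfl fun i _ => ?_
  rw [Matrix.conjTranspose_smul, (H.pauli i).toMatrix_isHermitian]
  simp

namespace PauliHamiltonian

variable {n m : ℕ} (H : PauliHamiltonian n m)

/-- The probability `⟨λₖ|ρ|λₖ⟩` of the `k`-th outcome when the state `ρ` is measured in an
orthonormal eigenbasis `|λₖ⟩` of `H`. -/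
def outcomeProb (ρ : Operator n) (k : Fin n → Fin 2) : ℝ :=
  (star (H.toMatrix_isHermitian.eigenvectorBasis k).ofLp ⬝ᵥ
    (ρ.mulVec (H.toMatrix_isHermitian.eigenvectorBasis k).ofLp)).re

/-- The expected energy `⟨E⟩ = ∑ₖ λₖ ⟨λₖ|ρ_𝒫(H)|λₖ⟩` obtained upon measuring `ρ_𝒫(H)` in the
eigenbasis of `H`. -/
def expectedEnergy (P : ℝ[X]) : ℝ :=
  ∑ k, H.toMatrix_isHermitian.eigenvalues k * H.outcomeProb (H.polyState P) k

/-- The expected number `⟨s⟩ = ∑ᵢ Tr[ρ_𝒫(H) (1 + vᵢ Pᵢ) / 2]` of satisfied terms in the state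
`ρ_𝒫(H)`. The term `vᵢ Pᵢ` is satisfied when its measurement gives the outcome `+1`;
`(1 + vᵢ Pᵢ) / 2` is the projection for that outcome. -/
def expectedSatisfied (P : ℝ[X]) : ℝ :=
  ∑ i, (Matrix.trace (H.polyState P * ((1 / 2 : ℂ) • (1 + H.term i)))).re

/-- `P` is an optimal choice of a polynomial of degree at most `ℓ`: it defines a state and
maximizes the expected energy among all such polynomials that define a state. -/
def IsOptimal (ℓ : ℕ) (P : ℝ[X]) : Prop :=
  (P.natDegree ≤ ℓ ∧ aeval H.toMatrix P ≠ 0) ∧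
    ∀ Q : ℝ[X], Q.natDegree ≤ ℓ → aeval H.toMatrix Q ≠ 0 →
      H.expectedEnergy Q ≤ H.expectedEnergy P

end PauliHamiltonian

end HDQI

end

/-! The terms `vᵢPᵢ` commute and square to 1, so a polynomial in `H` is a combination of products of
distinct terms. A nonempty product of fewer than `d^⊥` terms is, up to a scalar, a non-identity
Pauli operator and hence traceless (`trace_termProd`). Below that length the terms therefore have
the joint moments of independent unbiased signs.

Let `E_k` be the sum of all products of `k` distinct terms (`esymm`). Then `H E_k = (k+1) E_{k+1} +
(m-k+1) E_{k-1}`, so polynomials of degree at most `ℓ` in `H` are exactly the combinations of `E_0,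
…, E_ℓ`. Since `2ℓ+1 < d^⊥`, the traces of `A²` and `H A²` for `A = ∑ a_k E_k` depend on `m`, `ℓ`
and `a` only, up to the factor `2^n` (`normForm`, `energyForm`). In the coordinates `x_k = a_k
√C(m,k)` their quotient is the Rayleigh quotient of a Jacobi matrix with zero diagonal and
off-diagonal entries `√((k+1)(m-k))`.

A maximizer exists by compactness. Up to lower-order terms, the maximum is twice the largest
off-diagonal entry: AM-GM gives the upper bound (`energyForm_le`), and a flat vector on a window of
about `√m` indices near `min(ℓ, m/2)` gives the lower bound (`exists_le_energyForm`). Divided by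
`m`, both tend to `2√(ν(1-ν))` with `ν = min(μ, 1/2)`, which is `2σ(μ) - 1`. -/

namespace HDQI

/-! ### Multiplication and traces of Pauli operators -/

/-- The product of two Pauli operators up to a phase. -/
def Pauli.mul : Pauli → Pauli → Pauli
  | Pauli.I, q => q
  | p, Pauli.I => p
  | Pauli.X, Pauli.X => Pauli.I
  | Pauli.X, Pauli.Y => Pauli.Z
  | Pauli.X, Pauli.Z => Pauli.Y
  | Pauli.Y, Pauli.X => Pauli.Z
  | Pauli.Y, Pauli.Y => Pauli.I
  | Pauli.Y, Pauli.Z => Pauli.X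
  | Pauli.Z, Pauli.X => Pauli.Y
  | Pauli.Z, Pauli.Y => Pauli.X
  | Pauli.Z, Pauli.Z => Pauli.I

theorem Pauli.xBit_mul (p q : Pauli) : (p.mul q).xBit = p.xBit + q.xBit := by
  cases p <;> cases q <;> simp [Pauli.mul, Pauli.xBit] <;> decide

theorem Pauli.zBit_mul (p q : Pauli) : (p.mul q).zBit = p.zBit + q.zBit := by
  cases p <;> cases q <;> simp [Pauli.mul, Pauli.zBit] <;> decide

/-- The phase of the product of two Pauli operators. -/
noncomputable def Pauli.phase : Pauli → Pauli → ℂ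
  | Pauli.X, Pauli.Y => Complex.I
  | Pauli.Y, Pauli.X => -Complex.I
  | Pauli.Y, Pauli.Z => Complex.I
  | Pauli.Z, Pauli.Y => -Complex.I
  | Pauli.Z, Pauli.X => Complex.I
  | Pauli.X, Pauli.Z => -Complex.I
  | _, _ => 1

theorem Pauli.toMatrix_mul (p q : Pauli) :
    p.toMatrix * q.toMatrix = p.phase q • (p.mul q).toMatrix := by
  cases p <;> cases q <;> ext i j <;> fin_cases i <;> fin_cases j <;>
    simp [Pauli.mul, Pauli.phase, Pauli.toMatrix, Matrix.mul_apply]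

theorem Pauli.toMatrix_mul_self (p : Pauli) : p.toMatrix * p.toMatrix = 1 := by
  cases p <;> ext i j <;> fin_cases i <;> fin_cases j <;>
    simp [Pauli.toMatrix, Matrix.mul_apply]

theorem Pauli.trace_toMatrix_eq_zero {p : Pauli} (h : p.xBit ≠ 0 ∨ p.zBit ≠ 0) :
    ∑ b, p.toMatrix b b = 0 := by
  cases p <;> simp_all [Pauli.toMatrix, Pauli.xBit, Pauli.zBit]

theorem PauliString.toMatrix_mul_apply {n : ℕ} (P Q : PauliString n) (x y : Fin n → Fin 2) :
    (P.toMatrix * Q.toMatrix) x y =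
      ∏ q, ((P q).toMatrix * (Q q).toMatrix) (x q) (y q) := by
  simp only [Matrix.mul_apply, PauliString.toMatrix, ← Finset.prod_mul_distrib]
  exact (Fintype.prod_sum fun q b => (P q).toMatrix (x q) b * (Q q).toMatrix b (y q)).symm

theorem PauliString.toMatrix_mul {n : ℕ} (P Q : PauliString n) :
    P.toMatrix * Q.toMatrix =
      (∏ q, (P q).phase (Q q)) • PauliString.toMatrix fun q => (P q).mul (Q q) := by
  ext x y
  simp [PauliString.toMatrix_mul_apply, Pauli.toMatrix_mul, PauliString.toMatrix,
    Finset.prod_mul_distrib]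

theorem PauliString.toMatrix_mul_self {n : ℕ} (P : PauliString n) :
    P.toMatrix * P.toMatrix = 1 := by
  ext x y
  simp only [PauliString.toMatrix_mul_apply, Pauli.toMatrix_mul_self, Matrix.one_apply,
    Finset.prod_boole, Finset.mem_univ, true_imp_iff, funext_iff]

theorem PauliString.symp_mul {n : ℕ} (P Q : PauliString n) :
    PauliString.symp (fun q => (P q).mul (Q q)) = P.symp + Q.symp := by
  ext (q | q) <;> simp [PauliString.symp, Pauli.xBit_mul, Pauli.zBit_mul]

/-- The trace factors over the qubits, and a nonzero symplectic coordinate marks a factor `X`, `Y`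
or `Z`, whose trace vanishes. -/
theorem PauliString.trace_toMatrix_eq_zero {n : ℕ} {P : PauliString n} (h : P.symp ≠ 0) :
    P.toMatrix.trace = 0 := by
  have key : P.toMatrix.trace = ∏ q, ∑ b, (P q).toMatrix b b :=
    (Fintype.prod_sum fun q b => (P q).toMatrix b b).symm
  obtain ⟨a, ha⟩ := Function.ne_iff.1 h
  rw [key]
  rcases a with q | q
  · exact Finset.prod_eq_zero (Finset.mem_univ q)
      (Pauli.trace_toMatrix_eq_zero (Or.inl (by simpa [PauliString.symp] using ha)))
  · exact Finset.prod_eq_zero (Finset.mem_univ q)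
      (Pauli.trace_toMatrix_eq_zero (Or.inr (by simpa [PauliString.symp] using ha)))

/-! ### Products of terms and the role of the minimum distance -/

namespace PauliHamiltonian

variable {n m : ℕ} {H : PauliHamiltonian n m}

theorem term_mul_self (i : Fin m) : H.term i * H.term i = 1 := by
  have h : ((H.sign i : ℤ) : ℂ) * ((H.sign i : ℤ) : ℂ) = 1 := by
    rw [← Int.cast_mul, ← Units.val_mul, Int.units_mul_self]; simp
  simp [term, smul_smul, PauliString.toMatrix_mul_self, h]

theorem IsCommuting.term_commute (hc : H.IsCommuting) (i j : Fin m) :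
    Commute (H.term i) (H.term j) :=
  ((hc i j).smul_left _).smul_right _

/-- The product of the terms in `S`. -/
noncomputable def termProd (hc : H.IsCommuting) (S : Finset (Fin m)) : Operator n :=
  S.noncommProd H.term fun i _ j _ _ => hc.term_commute i j

theorem termProd_empty (hc : H.IsCommuting) : termProd hc ∅ = 1 :=
  Finset.noncommProd_empty _ _

theorem termProd_insert (hc : H.IsCommuting) {i : Fin m} {S : Finset (Fin m)} (hi : i ∉ S) :
    termProd hc (insert i S) = H.term i * termProd hc S :=
  Finset.noncommProd_insert_of_notMem _ _ _ _ hi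

theorem term_mul_termProd (hc : H.IsCommuting) (i : Fin m) (S : Finset (Fin m)) :
    H.term i * termProd hc S = termProd hc (symmDiff {i} S) := by
  by_cases hi : i ∈ S
  · have h1 : symmDiff {i} S = S.erase i := by
      ext j; simp only [Finset.mem_symmDiff, Finset.mem_singleton, Finset.mem_erase]; grind
    rw [h1, ← Finset.insert_erase hi, termProd_insert hc (Finset.notMem_erase i S), ← mul_assoc,
      term_mul_self, one_mul, Finset.insert_erase hi]
  · have h1 : symmDiff {i} S = insert i S := by
      ext j; simp only [Finset.mem_symmDiff, Finset.mem_singleton, Finset.mem_insert]; grind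
    rw [h1, termProd_insert hc hi]

/-- Commuting involutions: every factor common to both products cancels. -/
theorem termProd_mul (hc : H.IsCommuting) (S T : Finset (Fin m)) :
    termProd hc S * termProd hc T = termProd hc (symmDiff S T) := by
  induction S using Finset.induction_on with
  | empty => rw [termProd_empty, one_mul, ← Finset.bot_eq_empty, bot_symmDiff]
  | insert i S hi ih =>
    have h1 : insert i S = symmDiff {i} S := by
      ext j; simp only [Finset.mem_symmDiff, Finset.mem_singleton, Finset.mem_insert]; grind
    rw [h1, ← term_mul_termProd, mul_assoc, ih, term_mul_termProd, symmDiff_assoc]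

theorem exists_termProd_eq_smul (hc : H.IsCommuting) (S : Finset (Fin m)) :
    ∃ (c : ℂ) (Q : PauliString n), termProd hc S = c • Q.toMatrix ∧
      Q.symp = ∑ i ∈ S, (H.pauli i).symp := by
  induction S using Finset.induction_on with
  | empty =>
    refine ⟨1, fun _ => Pauli.I, ?_, ?_⟩
    · rw [termProd_empty, one_smul]
      ext x y
      have h : Pauli.I.toMatrix = 1 := by
        ext i j; fin_cases i <;> fin_cases j <;> simp [Pauli.toMatrix]
      simp only [PauliString.toMatrix, h, Matrix.one_apply, Finset.prod_boole, Finset.mem_univ,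
        true_imp_iff, funext_iff]
    · ext (q | q) <;> simp [PauliString.symp, Pauli.xBit, Pauli.zBit]
  | insert i S hi ih =>
    obtain ⟨c, Q, h1, h2⟩ := ih
    refine ⟨((H.sign i : ℤ) : ℂ) * c * ∏ q, (H.pauli i q).phase (Q q),
      fun q => (H.pauli i q).mul (Q q), ?_, ?_⟩
    · rw [termProd_insert hc hi, h1, term, smul_mul_smul_comm, PauliString.toMatrix_mul, smul_smul]
    · rw [PauliString.symp_mul, h2, Finset.sum_insert hi]

/-- Otherwise the indicator vector of `S` would be a nonzero codeword of weight `S.card`, below the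
minimum distance. -/
theorem sum_symp_ne_zero {S : Finset (Fin m)} (hS : S.Nonempty)
    (hd : (S.card : ℕ∞) < H.sympDist) : ∑ i ∈ S, (H.pauli i).symp ≠ 0 := by
  classical
  intro h0
  let y : Fin m → ZMod 2 := fun i => if i ∈ S then 1 else 0
  have hy : y ∈ H.sympCode := by
    rw [sympCode, LinearMap.mem_ker]
    ext a
    have := congrFun h0 a
    simpa [Matrix.mulVec, dotProduct, parityCheck, y] using this
  have hy0 : y ≠ 0 := by
    obtain ⟨i, hi⟩ := hS
    intro h
    have := congrFun h i
    simp [y, hi] at this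
  have hn : hammingNorm y = S.card := by
    simp [hammingNorm, y]
  have h2 : H.sympDist ≤ (hammingNorm y : ℕ∞) := iInf₂_le y ⟨hy, hy0⟩
  rw [hn] at h2
  exact absurd hd (not_lt.2 h2)

theorem trace_termProd (hc : H.IsCommuting) {S : Finset (Fin m)}
    (hd : (S.card : ℕ∞) < H.sympDist) :
    (termProd hc S).trace = if S = ∅ then 2 ^ n else 0 := by
  split_ifs with hS
  · rw [hS, termProd_empty, Matrix.trace_one]; simp
  · obtain ⟨c, Q, h1, h2⟩ := exists_termProd_eq_smul hc S
    rw [h1, Matrix.trace_smul, PauliString.trace_toMatrix_eq_zero, smul_zero]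
    rw [h2]
    exact sum_symp_ne_zero (Finset.nonempty_iff_ne_empty.2 hS) hd

/-! ### Elementary symmetric polynomials in the terms -/

/-- The elementary symmetric polynomial of degree `k` in the terms. -/
noncomputable def esymm (hc : H.IsCommuting) (k : ℕ) : Operator n :=
  ∑ S : Finset (Fin m), if S.card = k then termProd hc S else 0

theorem esymm_zero (hc : H.IsCommuting) : esymm hc 0 = 1 := by
  simp [esymm, termProd_empty]

theorem card_symmDiff_singleton (i : Fin m) (S : Finset (Fin m)) :
    (symmDiff {i} S).card = if i ∈ S then S.card - 1 else S.card + 1 := by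
  split_ifs with hi
  · have h1 : symmDiff {i} S = S.erase i := by
      ext j; simp only [Finset.mem_symmDiff, Finset.mem_singleton, Finset.mem_erase]; grind
    rw [h1, Finset.card_erase_of_mem hi]
  · have h1 : symmDiff {i} S = insert i S := by
      ext j; simp only [Finset.mem_symmDiff, Finset.mem_singleton, Finset.mem_insert]; grind
    rw [h1, Finset.card_insert_of_notMem hi]

/-- The coefficient of the product over `S` counts the `i` for which toggling `i` turns `S` into a
`k`-set: the elements of `S` if it has `k+1` elements, those of its complement if it has `k-1`, and
none otherwise. -/
theorem toMatrix_mul_esymm_eq_sum (hc : H.IsCommuting) (k : ℕ) :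
    H.toMatrix * esymm hc k = ∑ S : Finset (Fin m),
      (((if S.card = k + 1 then (k + 1 : ℝ) else 0) +
        if S.card + 1 = k then (m - k + 1 : ℝ) else 0)) • termProd hc S := by
  have h1 : H.toMatrix * esymm hc k = ∑ i : Fin m, ∑ S : Finset (Fin m),
      if (symmDiff {i} S).card = k then termProd hc S else 0 := by
    rw [toMatrix, Finset.sum_mul]
    refine Finset.sum_congr rfl fun i _ => ?_
    rw [esymm, Finset.mul_sum]
    -- For fixed `i`, toggling `i` is an involution on subsets, so the sum can be indexed by the
    -- resulting set.
    refine Finset.sum_bij' (fun S _ => symmDiff {i} S) (fun S _ => symmDiff {i} S)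
      (by simp) (by simp) (by simp [symmDiff_symmDiff_cancel_left])
      (by simp [symmDiff_symmDiff_cancel_left]) ?_
    intro S _
    rw [symmDiff_symmDiff_cancel_left, mul_ite, mul_zero, term_mul_termProd]
  rw [h1, Finset.sum_comm]
  refine Finset.sum_congr rfl fun S _ => ?_
  rw [← Finset.sum_filter, Finset.sum_const, ← Nat.cast_smul_eq_nsmul ℝ]
  congr 1
  by_cases h2 : S.card = k + 1
  · have : (Finset.univ.filter fun i => (symmDiff {i} S).card = k) = S := by
      ext i; simp only [card_symmDiff_singleton, Finset.mem_filter]; grind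
    rw [this, if_pos h2, if_neg (by omega), h2]; push_cast; ring
  · by_cases h3 : S.card + 1 = k
    · have : (Finset.univ.filter fun i => (symmDiff {i} S).card = k) = Sᶜ := by
        ext i
        simp only [card_symmDiff_singleton, Finset.mem_filter, Finset.mem_compl]; grind
      rw [this, if_neg h2, if_pos h3, Finset.card_compl, Fintype.card_fin,
        Nat.cast_sub (by simpa using Finset.card_le_univ S), ← h3]
      push_cast; ring
    · have : (Finset.univ.filter fun i => (symmDiff {i} S).card = k) = ∅ := by
        ext i
        by_cases hi : i ∈ S
        · have := Finset.card_pos.2 ⟨i, hi⟩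
          simp [card_symmDiff_singleton, hi]; omega
        · simp [card_symmDiff_singleton, hi]; omega
      rw [this, if_neg h2, if_neg h3]; simp

theorem smul_esymm (hc : H.IsCommuting) (c : ℝ) (k : ℕ) :
    c • esymm hc k = ∑ S : Finset (Fin m), (if S.card = k then c else 0) • termProd hc S := by
  rw [esymm, Finset.smul_sum]
  exact Finset.sum_congr rfl fun S _ => by split_ifs <;> simp

theorem toMatrix_mul_esymm_zero (hc : H.IsCommuting) :
    H.toMatrix * esymm hc 0 = esymm hc 1 := by
  rw [toMatrix_mul_esymm_eq_sum, ← one_smul ℝ (esymm hc 1), smul_esymm]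
  simp

theorem toMatrix_mul_esymm_succ (hc : H.IsCommuting) (k : ℕ) :
    H.toMatrix * esymm hc (k + 1) =
      (k + 2 : ℝ) • esymm hc (k + 2) + (m - k : ℝ) • esymm hc k := by
  rw [toMatrix_mul_esymm_eq_sum, smul_esymm, smul_esymm, ← Finset.sum_add_distrib]
  refine Finset.sum_congr rfl fun S _ => ?_
  rw [← add_smul]
  congr 1
  push_cast
  congr 1
  · exact if_congr Iff.rfl (by ring) rfl
  · exact if_congr (by omega) (by ring) rfl

/-- The product over `S` times the product over `T` involves at most `i + j` distinct terms, so its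
trace vanishes unless `S = T`. -/
theorem trace_esymm_mul_esymm (hc : H.IsCommuting) {i j : ℕ}
    (hd : ((i + j : ℕ) : ℕ∞) < H.sympDist) :
    (esymm hc i * esymm hc j).trace = if i = j then (2 : ℂ) ^ n * (m.choose i : ℂ) else 0 := by
  have h1 : (esymm hc i * esymm hc j).trace = ∑ S : Finset (Fin m), ∑ T : Finset (Fin m),
      if T = S then (if S.card = i ∧ i = j then (2 : ℂ) ^ n else 0) else 0 := by
    rw [esymm, esymm, Finset.sum_mul, Matrix.trace_sum]
    refine Finset.sum_congr rfl fun S _ => ?_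
    rw [Finset.mul_sum, Matrix.trace_sum]
    refine Finset.sum_congr rfl fun T _ => ?_
    by_cases hS : S.card = i
    · by_cases hT : T.card = j
      · rw [if_pos hS, if_pos hT, termProd_mul, trace_termProd]
        · simp only [Finset.symmDiff_eq_empty]
          by_cases hST : S = T
          · subst hST
            simp [hS, ← hT]
          · simp [hST, Ne.symm hST]
        · refine lt_of_le_of_lt ?_ hd
          rw [← hS, ← hT]
          have h2 : (symmDiff S T).card ≤ S.card + T.card :=
            (Finset.card_le_card (fun x hx => by
              simp only [Finset.mem_symmDiff] at hx
              simp only [Finset.mem_union]; tauto)).trans (Finset.card_union_le S T)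
          exact_mod_cast h2
      · rw [if_neg hT, mul_zero, Matrix.trace_zero]
        by_cases hST : T = S
        · subst hST; rw [if_pos rfl, if_neg]; rintro ⟨h, rfl⟩; exact hT h
        · rw [if_neg hST]
    · simp [hS]
  rw [h1]
  simp only [Finset.sum_ite_eq', Finset.mem_univ, if_true]
  by_cases hij : i = j
  · simp only [hij, and_true, if_true]
    rw [← Finset.sum_filter, Finset.sum_const, Finset.univ_filter_card_eq]
    · simp [mul_comm]
  · simp [hij]

theorem trace_toMatrix_mul_esymm_mul_esymm (hc : H.IsCommuting) {i j : ℕ}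
    (hd : ((i + j + 1 : ℕ) : ℕ∞) < H.sympDist) :
    (H.toMatrix * (esymm hc i * esymm hc j)).trace =
      (2 : ℂ) ^ n * ((if i + 1 = j then ((i + 1) * m.choose (i + 1) : ℂ) else 0) +
        if j + 1 = i then ((j + 1) * m.choose (j + 1) : ℂ) else 0) := by
  -- This identity brings the lowering coefficient of the recursion into the same form as the
  -- raising one, making the answer symmetric in `i` and `j`.
  have aux : ∀ k : ℕ, (m - k : ℂ) * m.choose k = (k + 1) * m.choose (k + 1) := by
    intro k
    rcases le_or_gt k m with hk | hk
    · have := Nat.choose_succ_right_eq m k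
      rw [← Nat.cast_sub hk, ← Nat.cast_mul, mul_comm, ← this]; push_cast; ring
    · rw [Nat.choose_eq_zero_of_lt hk, Nat.choose_eq_zero_of_lt (by omega)]; simp
  rw [← mul_assoc]
  rcases i with _ | i
  · rw [toMatrix_mul_esymm_zero, trace_esymm_mul_esymm hc (by convert hd using 2; ring)]
    by_cases h : 1 = j <;> simp [h]
    simp [← h]
  · have hd1 : ((i + 2 + j : ℕ) : ℕ∞) < H.sympDist := by convert hd using 2; ring
    have hd2 : ((i + j : ℕ) : ℕ∞) < H.sympDist :=
      lt_of_le_of_lt (by exact_mod_cast (by omega)) hd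
    rw [toMatrix_mul_esymm_succ, add_mul, smul_mul_assoc, smul_mul_assoc, Matrix.trace_add,
      Matrix.trace_smul, Matrix.trace_smul, trace_esymm_mul_esymm hc hd1,
      trace_esymm_mul_esymm hc hd2, mul_add]
    congr 1
    · by_cases h : i + 2 = j
      · rw [if_pos h, if_pos (by omega), Complex.real_smul]; push_cast; ring
      · rw [if_neg h, if_neg (by omega)]; simp
    · by_cases h : i = j
      · subst h
        rw [if_pos rfl, if_pos rfl, ← aux, Complex.real_smul]; push_cast; ring
      · rw [if_neg h, if_neg (by omega)]; simp

end PauliHamiltonian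

end HDQI

/-! ### Expected energy as a quotient of quadratic forms -/

namespace HDQI

open Polynomial

namespace PauliHamiltonian

variable {n m : ℕ} {H : PauliHamiltonian n m}

/-- The trace is computed in the eigenbasis of `H`, where `H` acts on each basis vector as its
eigenvalue. -/
theorem expectedEnergy_eq_trace (H : PauliHamiltonian n m) (P : ℝ[X]) :
    H.expectedEnergy P = (H.polyState P * H.toMatrix).trace.re := by
  set hH := H.toMatrix_isHermitian
  set ρ := H.polyState P
  let U : Operator n := hH.eigenvectorUnitary
  have hU : U * U.conjTranspose = 1 := Unitary.coe_mul_star_self hH.eigenvectorUnitary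
  have h1 : (ρ * H.toMatrix).trace = (U.conjTranspose * (ρ * H.toMatrix * U)).trace := by
    rw [Matrix.trace_mul_comm U.conjTranspose, mul_assoc, hU, mul_one]
  rw [h1, Matrix.trace, Complex.re_sum, expectedEnergy]
  refine Finset.sum_congr rfl fun k _ => ?_
  have h2 : ∀ M : Operator n, (U.conjTranspose * (M * U)) k k =
      star (hH.eigenvectorBasis k).ofLp ⬝ᵥ (M.mulVec (hH.eigenvectorBasis k).ofLp) := by
    intro M
    simp only [Matrix.mul_apply, dotProduct, Matrix.mulVec, Matrix.conjTranspose_apply,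
      Pi.star_apply]
    rfl
  rw [Matrix.diag_apply, h2, ← Matrix.mulVec_mulVec, hH.mulVec_eigenvectorBasis,
    Matrix.mulVec_smul, dotProduct_smul, Complex.smul_re, smul_eq_mul]
  rfl

theorem expectedSatisfied_eq (H : PauliHamiltonian n m) (P : ℝ[X])
    (hP : ((aeval H.toMatrix P) ^ 2).trace ≠ 0) :
    H.expectedSatisfied P = (m + H.expectedEnergy P) / 2 := by
  have h1 : (H.polyState P).trace = 1 := by
    rw [polyState, Matrix.trace_smul, smul_eq_mul, inv_mul_cancel₀ hP]
  have h2 : ∀ i, (H.polyState P * ((1 / 2 : ℂ) • (1 + H.term i))).trace.re =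
      (1 + (H.polyState P * H.term i).trace.re) / 2 := by
    intro i
    have h3 : (1 / 2 : ℂ) = ((1 / 2 : ℝ) : ℂ) := by push_cast; rfl
    rw [mul_smul_comm, mul_add, mul_one, Matrix.trace_smul, Matrix.trace_add, h1, smul_eq_mul,
      h3, Complex.re_ofReal_mul, Complex.add_re, Complex.one_re]
    ring
  rw [expectedEnergy_eq_trace, expectedSatisfied, toMatrix, Finset.mul_sum, Matrix.trace_sum,
    Complex.re_sum, Finset.sum_congr rfl fun i _ => h2 i, ← Finset.sum_div,
    Finset.sum_add_distrib]
  simp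

/-- The polynomials in `H` of degree at most `d` are combinations of the `esymm hc k`. -/
theorem exists_aeval_eq_sum_esymm (hc : H.IsCommuting) {d : ℕ} {P : ℝ[X]}
    (hP : P.natDegree ≤ d) :
    ∃ a : ℕ → ℝ, aeval H.toMatrix P = ∑ k ∈ Finset.range (d + 1), a k • esymm hc k := by
  let W : ℕ → Submodule ℝ (Operator n) := fun j =>
    Submodule.span ℝ (esymm hc '' (Finset.range (j + 1) : Set ℕ))
  have hmono : Monotone W := fun i j hij => Submodule.span_mono (Set.image_mono (by
    intro x; simp only [Finset.coe_range, Set.mem_Iio]; omega))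
  have hmem : ∀ {k j : ℕ}, k ≤ j → esymm hc k ∈ W j := fun {k j} h =>
    Submodule.subset_span ⟨k, by simpa [Nat.lt_succ_iff] using h, rfl⟩
  have hmul : ∀ j, ∀ A ∈ W j, H.toMatrix * A ∈ W (j + 1) := by
    intro j A hA
    induction hA using Submodule.span_induction with
    | mem A hA =>
      obtain ⟨k, hk, rfl⟩ := hA
      have hk : k < j + 1 := by simpa using hk
      rcases k with _ | k
      · rw [toMatrix_mul_esymm_zero]; exact hmem (by omega)
      · rw [toMatrix_mul_esymm_succ]
        exact add_mem (Submodule.smul_mem _ _ (hmem (by omega)))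
          (Submodule.smul_mem _ _ (hmem (by omega)))
    | zero => rw [mul_zero]; exact zero_mem _
    | add A B _ _ hA hB => rw [mul_add]; exact add_mem hA hB
    | smul c A _ hA => rw [mul_smul_comm]; exact Submodule.smul_mem _ _ hA
  have hpow : ∀ j, H.toMatrix ^ j ∈ W j := by
    intro j
    induction j with
    | zero => rw [pow_zero, ← esymm_zero hc]; exact hmem le_rfl
    | succ j ih => rw [pow_succ']; exact hmul j _ ih
  have hPW : aeval H.toMatrix P ∈ W d := by
    rw [aeval_eq_sum_range' (Nat.lt_succ_of_le hP)]
    refine sum_mem fun j hj => Submodule.smul_mem _ _ (hmono ?_ (hpow j))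
    exact Nat.lt_succ_iff.1 (Finset.mem_range.1 hj)
  obtain ⟨c, hc'⟩ := (Submodule.mem_span_image_finset_iff_exists_fun ℝ).1 hPW
  refine ⟨fun k => if h : k ∈ Finset.range (d + 1) then c ⟨k, h⟩ else 0, ?_⟩
  rw [← hc', ← Finset.sum_coe_sort (Finset.range (d + 1))]
  exact Finset.sum_congr rfl fun k _ => by simp

/-- The three-term recursion can be solved for its top term, whose coefficient `k + 2` is nonzero.
-/
theorem exists_aeval_eq_esymm (hc : H.IsCommuting) (k : ℕ) :
    ∃ P : ℝ[X], P.natDegree ≤ k ∧ aeval H.toMatrix P = esymm hc k := by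
  induction k using Nat.twoStepInduction with
  | zero => exact ⟨1, by simp, by simp [esymm_zero]⟩
  | one => exact ⟨X, natDegree_X_le, by rw [aeval_X, ← toMatrix_mul_esymm_zero, esymm_zero, mul_one]⟩
  | more k h0 h1 =>
    obtain ⟨P, hP, hP'⟩ := h0
    obtain ⟨Q, hQ, hQ'⟩ := h1
    refine ⟨C (k + 2 : ℝ)⁻¹ * (X * Q - C (m - k : ℝ) * P), ?_, ?_⟩
    · refine (natDegree_C_mul_le _ _).trans ((natDegree_sub_le _ _).trans (max_le ?_ ?_))
      · exact natDegree_mul_le.trans (by rw [natDegree_X]; omega)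
      · exact (natDegree_C_mul_le _ _).trans (by omega)
    · have hk : (k + 2 : ℝ) ≠ 0 := by positivity
      rw [map_mul, map_sub, map_mul, map_mul, aeval_X, aeval_C, aeval_C, hP', hQ',
        toMatrix_mul_esymm_succ, ← Algebra.smul_def, ← Algebra.smul_def, add_sub_cancel_right,
        smul_smul, inv_mul_cancel₀ hk, one_smul]

theorem exists_aeval_eq_of_coeff (hc : H.IsCommuting) (d : ℕ) (a : ℕ → ℝ) :
    ∃ P : ℝ[X], P.natDegree ≤ d ∧
      aeval H.toMatrix P = ∑ k ∈ Finset.range (d + 1), a k • esymm hc k := by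
  choose K hK hK' using exists_aeval_eq_esymm hc
  refine ⟨∑ k ∈ Finset.range (d + 1), C (a k) * K k, ?_, ?_⟩
  · refine natDegree_sum_le_of_forall_le _ _ fun k hk => ?_
    have := Finset.mem_range.1 hk
    exact (natDegree_C_mul_le _ _).trans ((hK k).trans (by omega))
  · rw [map_sum]
    refine Finset.sum_congr rfl fun k _ => ?_
    rw [map_mul, aeval_C, hK', ← Algebra.smul_def]

/-- `Tr[A²] / 2ⁿ` for `A = ∑ₖ aₖ Eₖ`. -/
noncomputable def normForm (m d : ℕ) (a : ℕ → ℝ) : ℝ :=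
  ∑ k ∈ Finset.range (d + 1), a k ^ 2 * m.choose k

/-- `Tr[H A²] / 2ⁿ` for `A = ∑ₖ aₖ Eₖ`. -/
noncomputable def energyForm (m d : ℕ) (a : ℕ → ℝ) : ℝ :=
  2 * ∑ k ∈ Finset.range d, a k * a (k + 1) * ((k + 1) * m.choose (k + 1))

theorem trace_sq_sum_esymm (hc : H.IsCommuting) {d : ℕ}
    (hd : ((2 * d + 1 : ℕ) : ℕ∞) < H.sympDist) (a : ℕ → ℝ) :
    ((∑ k ∈ Finset.range (d + 1), a k • esymm hc k) ^ 2).trace =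
      2 ^ n * (normForm m d a : ℂ) := by
  have h1 : ((∑ k ∈ Finset.range (d + 1), a k • esymm hc k) ^ 2).trace =
      ∑ i ∈ Finset.range (d + 1), ∑ j ∈ Finset.range (d + 1),
        if i = j then (a i * a j : ℂ) * (2 ^ n * m.choose i) else 0 := by
    rw [sq, Finset.sum_mul_sum, Matrix.trace_sum]
    refine Finset.sum_congr rfl fun i hi => ?_
    rw [Matrix.trace_sum]
    refine Finset.sum_congr rfl fun j hj => ?_
    rw [Finset.mem_range] at hi hj
    rw [smul_mul_smul_comm, Matrix.trace_smul, trace_esymm_mul_esymm, Complex.real_smul, mul_ite,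
      mul_zero, Complex.ofReal_mul]
    exact lt_of_le_of_lt (by exact_mod_cast (by omega)) hd
  rw [h1, normForm, Complex.ofReal_sum, Finset.mul_sum]
  refine Finset.sum_congr rfl fun i hi => ?_
  rw [Finset.sum_ite_eq, if_pos hi]
  push_cast; ring

theorem trace_toMatrix_mul_sq_sum_esymm (hc : H.IsCommuting) {d : ℕ}
    (hd : ((2 * d + 1 : ℕ) : ℕ∞) < H.sympDist) (a : ℕ → ℝ) :
    (H.toMatrix * (∑ k ∈ Finset.range (d + 1), a k • esymm hc k) ^ 2).trace =
      2 ^ n * (energyForm m d a : ℂ) := by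
  have h1 : (H.toMatrix * (∑ k ∈ Finset.range (d + 1), a k • esymm hc k) ^ 2).trace =
      ∑ i ∈ Finset.range (d + 1), ∑ j ∈ Finset.range (d + 1),
        ((if i + 1 = j then (a i * a j : ℂ) * (2 ^ n * ((i + 1) * m.choose (i + 1))) else 0) +
        if j + 1 = i then (a i * a j : ℂ) * (2 ^ n * ((j + 1) * m.choose (j + 1))) else 0) := by
    rw [sq, Finset.sum_mul_sum, Finset.mul_sum, Matrix.trace_sum]
    refine Finset.sum_congr rfl fun i hi => ?_
    rw [Finset.mul_sum, Matrix.trace_sum]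
    refine Finset.sum_congr rfl fun j hj => ?_
    rw [Finset.mem_range] at hi hj
    rw [smul_mul_smul_comm, mul_smul_comm, Matrix.trace_smul,
      trace_toMatrix_mul_esymm_mul_esymm, Complex.real_smul, Complex.ofReal_mul]
    · split_ifs <;> ring
    · exact lt_of_le_of_lt (by exact_mod_cast (by omega)) hd
  have h2 : ∀ f : ℕ → ℕ → ℂ, ∑ i ∈ Finset.range (d + 1), ∑ j ∈ Finset.range (d + 1),
      (if i + 1 = j then f i j else 0) = ∑ i ∈ Finset.range d, f i (i + 1) := by
    intro f
    simp only [Finset.sum_ite_eq]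
    rw [Finset.sum_range_succ, if_neg (by simp), add_zero]
    refine Finset.sum_congr rfl fun i hi => if_pos ?_
    simpa using hi
  simp only [h1, Finset.sum_add_distrib]
  rw [h2 fun i j => (a i * a j : ℂ) * (2 ^ n * ((i + 1) * m.choose (i + 1))), Finset.sum_comm,
    h2 fun j i => (a i * a j : ℂ) * (2 ^ n * ((j + 1) * m.choose (j + 1))),
    ← Finset.sum_add_distrib, energyForm, Complex.ofReal_mul, Complex.ofReal_sum, Finset.mul_sum,
    Finset.mul_sum]
  refine Finset.sum_congr rfl fun i _ => ?_
  push_cast; ring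

open scoped ComplexOrder in
-- A real polynomial of a Hermitian matrix is Hermitian, so the trace of its square is its squared
-- Frobenius norm.
theorem trace_sq_aeval_eq_zero_iff (H : PauliHamiltonian n m) (P : ℝ[X]) :
    ((aeval H.toMatrix P) ^ 2).trace = 0 ↔ aeval H.toMatrix P = 0 := by
  have hA : (aeval H.toMatrix P).conjTranspose = aeval H.toMatrix P := by
    rw [aeval_eq_sum_range, Matrix.conjTranspose_sum]
    refine Finset.sum_congr rfl fun k _ => ?_
    rw [Matrix.conjTranspose_smul, Matrix.conjTranspose_pow, H.toMatrix_isHermitian]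
    simp
  rw [sq]
  nth_rewrite 1 [← hA]
  exact Matrix.trace_conjTranspose_mul_self_eq_zero_iff

theorem expectedEnergy_eq_div (hc : H.IsCommuting) {d : ℕ}
    (hd : ((2 * d + 1 : ℕ) : ℕ∞) < H.sympDist) {P : ℝ[X]} {a : ℕ → ℝ}
    (hP : aeval H.toMatrix P = ∑ k ∈ Finset.range (d + 1), a k • esymm hc k) :
    H.expectedEnergy P = energyForm m d a / normForm m d a := by
  rw [expectedEnergy_eq_trace, Matrix.trace_mul_comm, polyState, mul_smul_comm,
    Matrix.trace_smul, hP, trace_toMatrix_mul_sq_sum_esymm hc hd, trace_sq_sum_esymm hc hd,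
    smul_eq_mul]
  have h2 : (2 : ℂ) ^ n ≠ 0 := pow_ne_zero _ two_ne_zero
  have h3 : ((2 : ℂ) ^ n * (normForm m d a : ℂ))⁻¹ * (2 ^ n * (energyForm m d a : ℂ)) =
      ((energyForm m d a / normForm m d a : ℝ) : ℂ) := by
    rw [mul_inv, mul_mul_mul_comm, inv_mul_cancel₀ h2]; push_cast; ring
  rw [h3, Complex.ofReal_re]

theorem aeval_eq_zero_iff (hc : H.IsCommuting) {d : ℕ}
    (hd : ((2 * d + 1 : ℕ) : ℕ∞) < H.sympDist) {P : ℝ[X]} {a : ℕ → ℝ}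
    (hP : aeval H.toMatrix P = ∑ k ∈ Finset.range (d + 1), a k • esymm hc k) :
    aeval H.toMatrix P = 0 ↔ normForm m d a = 0 := by
  rw [← trace_sq_aeval_eq_zero_iff, hP, trace_sq_sum_esymm hc hd]
  simp

end PauliHamiltonian

end HDQI

/-! ### Extremal analysis of the Rayleigh quotient -/

namespace HDQI

open Polynomial

namespace PauliHamiltonian

theorem normForm_nonneg (m d : ℕ) (a : ℕ → ℝ) : 0 ≤ normForm m d a :=
  Finset.sum_nonneg fun _ _ => by positivity

theorem exists_isMax_energyForm_div_normForm (m d : ℕ) :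
    ∃ a, normForm m d a ≠ 0 ∧ ∀ b, normForm m d b ≠ 0 →
      energyForm m d b / normForm m d b ≤ energyForm m d a / normForm m d a := by
  have hnc : Continuous (normForm m d) := by unfold normForm; fun_prop
  have hec : Continuous (energyForm m d) := by unfold energyForm; fun_prop
  -- The unit level set alone is not compact, since the form ignores all but finitely many
  -- coordinates; the cube makes it so by Tychonoff.
  let K : Set (ℕ → ℝ) := Set.univ.pi (fun _ => Set.Icc (-1) 1) ∩ {a | normForm m d a = 1}
  have hK : IsCompact K :=
    (isCompact_univ_pi fun _ => isCompact_Icc).inter_right (isClosed_eq hnc continuous_const)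
  have hne : K.Nonempty := by
    refine ⟨fun k => if k = 0 then 1 else 0, ?_, ?_⟩
    · intro k _
      by_cases hk : k = 0 <;> simp [hk]
    · simp [normForm]
  obtain ⟨a, ha, hmax⟩ := hK.exists_isMaxOn hne hec.continuousOn
  have ha1 : normForm m d a = 1 := ha.2
  refine ⟨a, by rw [ha1]; exact one_ne_zero, fun b hb => ?_⟩
  have hb0 : 0 < normForm m d b := (normForm_nonneg m d b).lt_of_ne' hb
  set s := √(normForm m d b)
  have hs : s ^ 2 = normForm m d b := Real.sq_sqrt hb0.le
  have hs0 : s ≠ 0 := (Real.sqrt_pos.2 hb0).ne'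
  -- Normalize `b` and clear the coordinates that neither form sees: those beyond `d`, and those
  -- beyond `m`, where the binomial vanishes. The remaining binomials are at least 1, so norm one
  -- puts `c` in the cube.
  let c : ℕ → ℝ := fun k => if k < d + 1 ∧ k ≤ m then b k / s else 0
  have hcn : normForm m d c = 1 := by
    have h1 : normForm m d c = normForm m d b / s ^ 2 := by
      rw [normForm, normForm, Finset.sum_div]
      refine Finset.sum_congr rfl fun k hk => ?_
      rw [Finset.mem_range] at hk
      by_cases hkm : k ≤ m
      · simp only [c, if_pos (And.intro hk hkm)]; ring
      · rw [Nat.choose_eq_zero_of_lt (by omega)]; simp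
    rw [h1, hs, div_self hb]
  have hce : energyForm m d c = energyForm m d b / normForm m d b := by
    rw [← hs, energyForm, energyForm, mul_div_assoc, Finset.sum_div]
    congr 1
    refine Finset.sum_congr rfl fun k hk => ?_
    rw [Finset.mem_range] at hk
    by_cases hkm : k + 1 ≤ m
    · have h1 : c k = b k / s := if_pos ⟨by omega, by omega⟩
      have h2 : c (k + 1) = b (k + 1) / s := if_pos ⟨by omega, by omega⟩
      rw [h1, h2]; ring
    · rw [Nat.choose_eq_zero_of_lt (by omega)]; simp
  have hcK : c ∈ K := by
    refine ⟨fun k _ => ?_, hcn⟩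
    by_cases hk : k < d + 1 ∧ k ≤ m
    · rw [Set.mem_Icc, ← abs_le, ← sq_le_one_iff_abs_le_one]
      calc c k ^ 2 ≤ c k ^ 2 * m.choose k := by
            refine le_mul_of_one_le_right (sq_nonneg _) ?_
            exact_mod_cast Nat.choose_pos hk.2
        _ ≤ normForm m d c := Finset.single_le_sum (f := fun k => c k ^ 2 * (m.choose k : ℝ))
            (fun _ _ => by positivity) (Finset.mem_range.2 hk.1)
        _ = 1 := hcn
    · have : c k = 0 := if_neg hk
      rw [this]; norm_num
  rw [ha1, div_one, ← hce]
  exact hmax hcK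

/-- Rescaling `a k` by `√(m.choose k)` thus leaves the Jacobi entry `√((k+1)(m-k))`. -/
theorem succ_mul_choose_succ_eq {m k : ℕ} (hk : k ≤ m) :
    ((k + 1) * m.choose (k + 1) : ℝ) =
      √((k + 1) * (m - k)) * (√(m.choose k) * √(m.choose (k + 1))) := by
  have h1 : ((k + 1) * m.choose (k + 1) : ℝ) = (m - k) * m.choose k := by
    have := Nat.choose_succ_right_eq m k
    rw [← Nat.cast_sub hk, ← Nat.cast_mul, mul_comm ((m - k : ℕ)), ← this]; push_cast; ring
  have h0 : (0 : ℝ) ≤ m - k := by rw [← Nat.cast_sub hk]; positivity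
  rw [← Real.sqrt_mul (by positivity), ← Real.sqrt_mul (by positivity), eq_comm,
    Real.sqrt_eq_iff_mul_self_eq (by positivity) (by positivity)]
  nth_rewrite 2 [h1]
  ring

/-- With `t = k + 1 ≤ d`, the squared Jacobi entry is `t(m+1-t)`, a parabola with vertex `(m+1)/2`;
hence the truncation of `d` there. AM-GM splits each cross term, and each square then occurs at most
twice. -/
theorem energyForm_le (m d : ℕ) (a : ℕ → ℝ) :
    energyForm m d a ≤ 2 * √(min (d : ℝ) ((m + 1) / 2) * (m + 1 - min (d : ℝ) ((m + 1) / 2))) *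
      normForm m d a := by
  set u := min (d : ℝ) ((m + 1) / 2)
  set M := √(u * (m + 1 - u))
  have hM : 0 ≤ M := Real.sqrt_nonneg _
  have hterm : ∀ k ∈ Finset.range d, a k * a (k + 1) * ((k + 1) * m.choose (k + 1)) ≤
      M / 2 * (a k ^ 2 * m.choose k + a (k + 1) ^ 2 * m.choose (k + 1)) := by
    intro k hk
    rw [Finset.mem_range] at hk
    rcases lt_or_ge k m with hkm | hkm
    · rw [succ_mul_choose_succ_eq hkm.le]
      have hle : √((k + 1) * (m - k) : ℝ) ≤ M := by
        refine Real.sqrt_le_sqrt ?_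
        have h1 : (k + 1 : ℝ) ≤ d := by exact_mod_cast hk
        have h2 : u ≤ (m + 1) / 2 := min_le_right _ _
        rcases min_choice (d : ℝ) ((m + 1) / 2) with h3 | h3
        · have h3 : u = d := h3
          rw [h3] at h2 ⊢
          nlinarith
        · have h3 : u = (m + 1) / 2 := h3
          rw [h3]
          nlinarith [sq_nonneg ((k + 1 : ℝ) - (m + 1) / 2)]
      set x := a k * √(m.choose k : ℝ)
      set y := a (k + 1) * √(m.choose (k + 1) : ℝ)
      have hx : a k ^ 2 * m.choose k = x ^ 2 := by
        rw [mul_pow, Real.sq_sqrt (by positivity)]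
      have hy : a (k + 1) ^ 2 * m.choose (k + 1) = y ^ 2 := by
        rw [mul_pow, Real.sq_sqrt (by positivity)]
      rw [hx, hy]
      calc a k * a (k + 1) * (√((k + 1) * (m - k)) *
            (√(m.choose k : ℝ) * √(m.choose (k + 1) : ℝ)))
          = √((k + 1) * (m - k)) * (x * y) := by ring
        _ ≤ √((k + 1) * (m - k)) * ((x ^ 2 + y ^ 2) / 2) :=
            mul_le_mul_of_nonneg_left (by nlinarith [sq_nonneg (x - y)]) (Real.sqrt_nonneg _)
        _ ≤ M * ((x ^ 2 + y ^ 2) / 2) := mul_le_mul_of_nonneg_right hle (by positivity)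
        _ = M / 2 * (x ^ 2 + y ^ 2) := by ring
    · rw [Nat.choose_eq_zero_of_lt (by omega : m < k + 1)]
      simp only [Nat.cast_zero, mul_zero, add_zero]
      positivity
  have h1 : ∑ k ∈ Finset.range d, a k ^ 2 * (m.choose k : ℝ) ≤ normForm m d a := by
    rw [normForm, Finset.sum_range_succ]
    exact le_add_of_nonneg_right (by positivity)
  have h2 : ∑ k ∈ Finset.range d, a (k + 1) ^ 2 * (m.choose (k + 1) : ℝ) ≤ normForm m d a := by
    rw [normForm, Finset.sum_range_succ' fun k => a k ^ 2 * (m.choose k : ℝ)]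
    exact le_add_of_nonneg_right (by positivity)
  have h3 := Finset.sum_le_sum hterm
  rw [← Finset.mul_sum, Finset.sum_add_distrib] at h3
  rw [energyForm]
  nlinarith

/-- The witness is the flat vector `x_k = 1` on the window `[p-r, p]`: it has `r + 1` entries and
`r` neighbouring pairs, each with Jacobi entry at least `√((p-r)(m-p))`. -/
theorem exists_le_energyForm {m d p r : ℕ} (hr : r ≤ p) (hpd : p ≤ d) (hpm : p ≤ m) :
    ∃ a, normForm m d a = r + 1 ∧
      2 * (r * √((p - r : ℕ) * (m - p))) ≤ energyForm m d a := by
  have hC : ∀ k ≤ p, (0 : ℝ) < m.choose k := fun k hk => by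
    exact_mod_cast Nat.choose_pos (hk.trans hpm)
  refine ⟨fun k => if k ∈ Finset.Icc (p - r) p then (√(m.choose k : ℝ))⁻¹ else 0, ?_, ?_⟩
  · have h1 : ∀ k ∈ Finset.range (d + 1),
        (if k ∈ Finset.Icc (p - r) p then (√(m.choose k : ℝ))⁻¹ else 0) ^ 2 * (m.choose k : ℝ) =
          if k ∈ Finset.Icc (p - r) p then 1 else 0 := by
      intro k _
      split_ifs with hk
      · have := hC k (Finset.mem_Icc.1 hk).2
        rw [inv_pow, Real.sq_sqrt this.le, inv_mul_cancel₀ this.ne']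
      · simp
    rw [normForm, Finset.sum_congr rfl h1, Finset.sum_ite_mem,
      Finset.inter_eq_right.2 (fun k hk => by
        rw [Finset.mem_Icc] at hk; rw [Finset.mem_range]; omega), Finset.sum_const, Nat.card_Icc,
      nsmul_one, show p + 1 - (p - r) = r + 1 by omega]
    push_cast; ring
  · rw [energyForm]
    refine mul_le_mul_of_nonneg_left ?_ zero_le_two
    have h1 : (r : ℝ) * √((p - r : ℕ) * (m - p)) = ∑ k ∈ Finset.range d,
        if k ∈ Finset.Ico (p - r) p then √((p - r : ℕ) * (m - p)) else 0 := by
      rw [Finset.sum_ite_mem,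
        Finset.inter_eq_right.2 (fun k hk => by
          rw [Finset.mem_Ico] at hk; rw [Finset.mem_range]; omega), Finset.sum_const, Nat.card_Ico,
        nsmul_eq_mul, show p - (p - r) = r by omega]
    rw [h1]
    refine Finset.sum_le_sum fun k _ => ?_
    split_ifs with h2 h3 h4 h4
    · rw [Finset.mem_Ico] at h2
      have hk := Real.sqrt_pos.2 (hC k h2.2.le)
      have hk' := Real.sqrt_pos.2 (hC (k + 1) h2.2)
      rw [succ_mul_choose_succ_eq (h2.2.le.trans hpm), ← mul_inv, mul_left_comm,
        inv_mul_cancel₀ (mul_pos hk hk').ne', mul_one]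
      refine Real.sqrt_le_sqrt (mul_le_mul ?_ ?_ ?_ (by positivity))
      · exact_mod_cast h2.1.trans (Nat.le_succ k)
      · have : (k : ℝ) ≤ p := by exact_mod_cast h2.2.le
        linarith
      · exact sub_nonneg.2 (by exact_mod_cast hpm)
    all_goals first
      | positivity
      | (exfalso; rw [Finset.mem_Ico] at h2; rw [Finset.mem_Icc] at *; omega)

variable {n m : ℕ} {H : PauliHamiltonian n m}

theorem exists_isOptimal (hc : H.IsCommuting) {d : ℕ}
    (hd : ((2 * d + 1 : ℕ) : ℕ∞) < H.sympDist) : ∃ P, H.IsOptimal d P := by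
  obtain ⟨a, ha, hmax⟩ := exists_isMax_energyForm_div_normForm m d
  obtain ⟨P, hP, hPa⟩ := exists_aeval_eq_of_coeff hc d a
  refine ⟨P, ⟨hP, mt (aeval_eq_zero_iff hc hd hPa).1 ha⟩, fun Q hQ hQ0 => ?_⟩
  obtain ⟨b, hQb⟩ := exists_aeval_eq_sum_esymm hc hQ
  rw [expectedEnergy_eq_div hc hd hPa, expectedEnergy_eq_div hc hd hQb]
  exact hmax b (mt (aeval_eq_zero_iff hc hd hQb).2 hQ0)

theorem IsOptimal.expectedEnergy_le (hc : H.IsCommuting) {d : ℕ}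
    (hd : ((2 * d + 1 : ℕ) : ℕ∞) < H.sympDist) {P : ℝ[X]} (hP : H.IsOptimal d P) :
    H.expectedEnergy P ≤
      2 * √(min (d : ℝ) ((m + 1) / 2) * (m + 1 - min (d : ℝ) ((m + 1) / 2))) := by
  obtain ⟨b, hPb⟩ := exists_aeval_eq_sum_esymm hc hP.1.1
  have hb := mt (aeval_eq_zero_iff hc hd hPb).2 hP.1.2
  rw [expectedEnergy_eq_div hc hd hPb, div_le_iff₀ ((normForm_nonneg m d b).lt_of_ne' hb)]
  exact energyForm_le m d b

theorem IsOptimal.le_expectedEnergy (hc : H.IsCommuting) {d : ℕ}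
    (hd : ((2 * d + 1 : ℕ) : ℕ∞) < H.sympDist) {P : ℝ[X]} (hP : H.IsOptimal d P)
    {p : ℕ} (r : ℕ) (hpd : p ≤ d) (hpm : p ≤ m) :
    2 * (r / (r + 1) * √((p - r : ℕ) * (m - p))) ≤ H.expectedEnergy P := by
  have key : ∀ {p r : ℕ}, r ≤ p → p ≤ d → p ≤ m →
      2 * (r / (r + 1) * √((p - r : ℕ) * (m - p))) ≤ H.expectedEnergy P := by
    intro p r hr hpd hpm
    obtain ⟨a, ha, hle⟩ := exists_le_energyForm hr hpd hpm
    obtain ⟨Q, hQ, hQa⟩ := exists_aeval_eq_of_coeff hc d a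
    have hr0 : (0 : ℝ) < r + 1 := by positivity
    refine le_trans ?_ (hP.2 Q hQ (mt (aeval_eq_zero_iff hc hd hQa).1 (by rw [ha]; exact hr0.ne')))
    rw [expectedEnergy_eq_div hc hd hQa, ha, le_div_iff₀ hr0]
    refine le_trans (le_of_eq ?_) hle
    field_simp
  rcases le_or_gt r p with hr | hr
  · exact key hr hpd hpm
  -- For `r > p` the truncated difference makes the bound zero, and the constant witness `p = r = 0`
  -- already gives nonnegative energy.
  · rw [Nat.sub_eq_zero_of_le hr.le]
    simpa using key (le_refl 0) (Nat.zero_le d) (Nat.zero_le m)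

end PauliHamiltonian

end HDQI

/-! ### Asymptotics -/

open Filter Topology

theorem tendsto_natSqrt_atTop : Tendsto Nat.sqrt atTop atTop :=
  tendsto_atTop.2 fun b => (eventually_ge_atTop (b * b)).mono fun _ h => Nat.le_sqrt.2 h

theorem tendsto_natSqrt_div_self :
    Tendsto (fun m : ℕ => (Nat.sqrt m : ℝ) / m) atTop (𝓝 0) := by
  have h1 : Tendsto (fun m : ℕ => ((Nat.sqrt m : ℕ) : ℝ)⁻¹) atTop (𝓝 0) :=
    tendsto_inv_atTop_zero.comp (tendsto_natCast_atTop_atTop.comp tendsto_natSqrt_atTop)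
  refine squeeze_zero' (Eventually.of_forall fun m => by positivity) ?_ h1
  filter_upwards [eventually_gt_atTop 0] with m hm
  have hs : (0 : ℝ) < Nat.sqrt m := by exact_mod_cast Nat.sqrt_pos.2 hm
  have hm' : (0 : ℝ) < m := by exact_mod_cast hm
  rw [div_le_iff₀ hm', inv_mul_eq_div, le_div_iff₀ hs]
  exact_mod_cast Nat.sqrt_le m

theorem tendsto_natHalf_div_self :
    Tendsto (fun m : ℕ => ((m / 2 : ℕ) : ℝ) / m) atTop (𝓝 (1 / 2)) := by
  have h := (tendsto_nat_floor_mul_div_atTop (R := ℝ) (a := 1 / 2) (by norm_num)).comp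
    (tendsto_natCast_atTop_atTop (R := ℝ))
  refine h.congr fun m => ?_
  have h1 : ⌊(1 / 2 : ℝ) * m⌋₊ = m / 2 := by
    rw [one_div_mul_eq_div]
    exact_mod_cast Nat.floor_div_eq_div (K := ℝ) m 2
  simp only [Function.comp_apply, h1]

namespace HDQI

theorem tendsto_div_of_jacobi_bounds {m d : ℕ → ℕ} {e : ℕ → ℝ} {μ : ℝ}
    (hm : Tendsto m atTop atTop) (hμ : Tendsto (fun j => (d j : ℝ) / m j) atTop (𝓝 μ))
    (hle : ∀ j, e j ≤ 2 * √(min (d j : ℝ) ((m j + 1) / 2) *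
      (m j + 1 - min (d j : ℝ) ((m j + 1) / 2))))
    (hge : ∀ j (p r : ℕ), p ≤ d j → p ≤ m j →
      2 * (r / (r + 1) * √((p - r : ℕ) * (m j - p))) ≤ e j) :
    Tendsto (fun j => e j / m j) atTop (𝓝 (2 * √(min μ (1 / 2) * (1 - min μ (1 / 2))))) := by
  set ν := min μ (1 / 2)
  have hμ0 : 0 ≤ μ := ge_of_tendsto' hμ fun j => by positivity
  have hν0 : 0 ≤ ν := le_min hμ0 (by norm_num)
  have hpos : ∀ᶠ j in atTop, 0 < m j := hm.eventually_gt_atTop 0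
  have hinv : Tendsto (fun j => 1 / (m j : ℝ)) atTop (𝓝 0) := by
    simp only [one_div]
    exact tendsto_inv_atTop_zero.comp (tendsto_natCast_atTop_atTop.comp hm)
  have hsqrt : ∀ {x y M : ℝ}, 0 < M → √(x * y) / M = √(x / M * (y / M)) := by
    intro x y M hM
    rw [div_mul_div_comm, Real.sqrt_div' _ (mul_self_nonneg M), Real.sqrt_mul_self hM.le]
  -- Lower bound with `p = min(d, m/2)` and `r = ⌊√m⌋`: the window grows, so `r/(r+1) → 1`, yet `r/m
  -- → 0`, so `p - r` and `p` have the same limit after division by `m`.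
  refine tendsto_of_tendsto_of_tendsto_of_le_of_le'
    (g := fun j => 2 * ((Nat.sqrt (m j) : ℝ) / (Nat.sqrt (m j) + 1) *
      √(((min (d j) (m j / 2) - Nat.sqrt (m j) : ℕ) : ℝ) / m j *
        (1 - (min (d j) (m j / 2) : ℕ) / m j))))
    (h := fun j => 2 * √(min ((d j : ℝ) / m j) ((1 + 1 / m j) / 2) *
      (1 + 1 / m j - min ((d j : ℝ) / m j) ((1 + 1 / m j) / 2)))) ?_ ?_ ?_ ?_
  · have hr : Tendsto (fun j => (Nat.sqrt (m j) : ℝ) / (Nat.sqrt (m j) + 1)) atTop (𝓝 1) :=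
      (tendsto_natCast_div_add_atTop (1 : ℝ)).comp (tendsto_natSqrt_atTop.comp hm)
    have hp : Tendsto (fun j => ((min (d j) (m j / 2) : ℕ) : ℝ) / m j) atTop (𝓝 ν) := by
      refine (hμ.min (tendsto_natHalf_div_self.comp hm)).congr fun j => ?_
      have hmj : (0 : ℝ) ≤ m j := by positivity
      rw [Nat.cast_min, ← min_div_div_right hmj]
      rfl
    have hq : Tendsto (fun j => ((min (d j) (m j / 2) - Nat.sqrt (m j) : ℕ) : ℝ) / m j) atTop
        (𝓝 ν) := by
      -- Truncated subtraction is the maximum of the real difference and 0, which also covers `p <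
      -- ⌊√m⌋`, possible when `ν = 0`.
      have h1 := (hp.sub (tendsto_natSqrt_div_self.comp hm)).max
        (tendsto_const_nhds (x := (0 : ℝ)))
      rw [sub_zero, max_eq_left hν0] at h1
      refine h1.congr fun j => ?_
      have hmj : (0 : ℝ) ≤ m j := by positivity
      simp only [Function.comp_apply]
      rw [← sub_div]
      rcases le_total (Nat.sqrt (m j)) (min (d j) (m j / 2)) with h | h
      · rw [Nat.cast_sub h, max_eq_left]
        exact div_nonneg (sub_nonneg.2 (by exact_mod_cast h)) hmj
      · rw [Nat.sub_eq_zero_of_le h, max_eq_right]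
        · simp
        · exact div_nonpos_of_nonpos_of_nonneg (sub_nonpos.2 (by exact_mod_cast h)) hmj
    simpa only [one_mul] using (hr.mul (hq.mul (hp.const_sub 1)).sqrt).const_mul 2
  · have h1 : Tendsto (fun j => 1 + 1 / (m j : ℝ)) atTop (𝓝 1) := by
      simpa using hinv.const_add 1
    have h2 : Tendsto (fun j => min ((d j : ℝ) / m j) ((1 + 1 / m j) / 2)) atTop (𝓝 ν) :=
      hμ.min (h1.div_const 2)
    exact ((h2.mul (h1.sub h2)).sqrt).const_mul 2
  · filter_upwards [hpos] with j hj
    have hj' : (0 : ℝ) < m j := by exact_mod_cast hj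
    rw [le_div_iff₀ hj']
    refine le_trans (le_of_eq ?_)
      (hge j (min (d j) (m j / 2)) (Nat.sqrt (m j)) (min_le_left _ _)
        ((min_le_right _ _).trans (Nat.div_le_self _ _)))
    rw [show (1 : ℝ) - (min (d j) (m j / 2) : ℕ) / m j = (m j - (min (d j) (m j / 2) : ℕ)) / m j by
      field_simp, ← hsqrt hj']
    field_simp
  · filter_upwards [hpos] with j hj
    have hj' : (0 : ℝ) < m j := by exact_mod_cast hj
    rw [div_le_iff₀ hj']
    refine (hle j).trans (le_of_eq ?_)
    have h1 : min ((d j : ℝ) / m j) ((1 + 1 / m j) / 2) = min (d j : ℝ) ((m j + 1) / 2) / m j := by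
      rw [show (1 + 1 / (m j : ℝ)) / 2 = ((m j + 1) / 2) / m j by field_simp,
        min_div_div_right hj'.le]
    rw [h1, show 1 + 1 / (m j : ℝ) - min (d j : ℝ) ((m j + 1) / 2) / m j =
      (m j + 1 - min (d j : ℝ) ((m j + 1) / 2)) / m j by field_simp, ← hsqrt hj']
    field_simp

/-- The two radicands sum to `1/2`, so after expanding the square only the cross term survives;
beyond `1/2` both sides are 1. -/
theorem two_mul_semicircle_sub_one {μ : ℝ} (hμ : 0 ≤ μ) :
    2 * (if μ ≤ 1 / 2 then (√(μ / 2) + √(1 / 2 - μ / 2)) ^ 2 else 1) - 1 =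
      2 * √(min μ (1 / 2) * (1 - min μ (1 / 2))) := by
  split_ifs with h
  · rw [min_eq_left h, add_sq, Real.sq_sqrt (by linarith), Real.sq_sqrt (by linarith), mul_assoc,
      ← Real.sqrt_mul (by linarith : 0 ≤ μ / 2),
      show μ * (1 - μ) = 2 ^ 2 * (μ / 2 * (1 / 2 - μ / 2)) by ring, Real.sqrt_mul (sq_nonneg (2 : ℝ)),
      Real.sqrt_sq (zero_le_two : (0 : ℝ) ≤ 2)]
    ring
  · rw [min_eq_right (not_le.1 h).le, show (1 / 2 : ℝ) * (1 - 1 / 2) = (1 / 2) ^ 2 by norm_num,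
      Real.sqrt_sq (by norm_num)]
    norm_num

end HDQI

theorem theorem2p4 (n m ℓ : ℕ → ℕ) (H : ∀ j, HDQI.PauliHamiltonian (n j) (m j)) (μ : ℝ)
    (hcomm : ∀ j, (H j).IsCommuting)
    (hdist : ∀ j, ((2 * ℓ j + 1 : ℕ) : ℕ∞) < (H j).sympDist)
    (hm : Filter.Tendsto m Filter.atTop Filter.atTop)
    (hμ : Filter.Tendsto (fun j => (ℓ j : ℝ) / (m j : ℝ)) Filter.atTop (nhds μ)) :
    (∀ j, ∃ P : Polynomial ℝ, (H j).IsOptimal (ℓ j) P) ∧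
      ∀ P : ℕ → Polynomial ℝ, (∀ j, (H j).IsOptimal (ℓ j) (P j)) →
        Filter.Tendsto (fun j => (H j).expectedSatisfied (P j) / (m j : ℝ)) Filter.atTop
            (nhds (if μ ≤ 1 / 2 then (√(μ / 2) + √(1 / 2 - μ / 2)) ^ 2 else 1)) ∧
          Filter.Tendsto (fun j => (H j).expectedEnergy (P j) / (m j : ℝ)) Filter.atTop
            (nhds (2 * (if μ ≤ 1 / 2 then (√(μ / 2) + √(1 / 2 - μ / 2)) ^ 2 else 1) - 1)) := by
  refine ⟨fun j => HDQI.PauliHamiltonian.exists_isOptimal (hcomm j) (hdist j), fun P hP => ?_⟩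
  have hμ0 : 0 ≤ μ := ge_of_tendsto' hμ fun j => by positivity
  have hE : Filter.Tendsto (fun j => (H j).expectedEnergy (P j) / (m j : ℝ)) Filter.atTop
      (nhds (2 * (if μ ≤ 1 / 2 then (√(μ / 2) + √(1 / 2 - μ / 2)) ^ 2 else 1) - 1)) := by
    rw [HDQI.two_mul_semicircle_sub_one hμ0]
    exact HDQI.tendsto_div_of_jacobi_bounds hm hμ
      (fun j => (hP j).expectedEnergy_le (hcomm j) (hdist j))
      (fun j p r => (hP j).le_expectedEnergy (hcomm j) (hdist j) r)
  refine ⟨?_, hE⟩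
  have h1 := (hE.const_add 1).div_const 2
  rw [add_sub_cancel, mul_div_cancel_left₀ _ two_ne_zero] at h1
  refine h1.congr' ?_
  filter_upwards [hm.eventually_gt_atTop 0] with j hj
  have hj' : (m j : ℝ) ≠ 0 := by exact_mod_cast hj.ne'
  rw [(H j).expectedSatisfied_eq (P j)
    (mt ((H j).trace_sq_aeval_eq_zero_iff (P j)).1 (hP j).1.2)]
  field_simp
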